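/- Let $R\subset S$ be a proper extension of commutative unital rings. Write $[R,S]$ for the lattice of $R$-subalgebras of $S$, with meet $T\cap U$ and join $TU$ (the subalgebra generated by $T$ and $U$). Assume that $R\subset S$ has FCP, that is, every chain in $[R,S]$ is finite. For $T\subseteq U$ in $[R,S]$ let $\mathrm{MSupp}(U/T)$ be the set of maximal ideals $M$ of $R$ such that the localized $R$-module $(U/T)_M$ is nonzero. Then the following conditions are equivalent: 1. every $T\in[R,S]$ is a splitter, that is, there is a subset $X\subseteq\mathrm{MSupp}(S/R)$ such that $\mathrm{MSupp}(T/R)=X$ and $\mathrm{MSupp}(S/T)=\mathrm{MSupp}(S/R)\setminus X$; 2. $R\subset S$ is locally minimal, that is, for each $M\in\mathrm{MSupp}(S/R)$ one has $R_M\neq S_M$ and $[R_M,S_M]=\{R_M,S_M\}$; 3. $[R,S]$ is finite (i.e. $R\subset S$ has FIP), $R\subset S$ is a $\mathcal B$-extension, i.e. the map $[R,S]\to\prod_{M\in\mathrm{MSupp}(S/R)}[R_M,S_M]$, $T\mapsto(T_M)_M$, is bijective, and $|[R,S]|=2^{|\mathrm{MSupp}(S/R)|}$; 4. $[R,S]$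 is finite, $R\subset S$ is Boolean, i.e. $[R,S]$ is a distributive lattice in which every $T$ has a complement $T'$ ($T\cap T'=R$ and $TT'=S$), and $R\subset S$ is arithmetic (locally chained), i.e. $[R_M,S_M]$ is totally ordered by inclusion for each $M\in\mathrm{MSupp}(S/R)$. -/

import Mathlib

namespace RingExt

universe u v

section Lattice

variable (R : Type u) (S : Type v) [CommRing R] [CommRing S] [Algebra R S]

/-- The extension `R ⊆ S` has FCP: every chain of `R`-subalgebras of `S` is finite. -/
def IsFCP : Prop :=
  ∀ C : Set (Subalgebra R S), IsChain (· ≤ ·) C → C.Finite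

/-- The extension `R ⊆ S` has FIP: `[R, S]` is finite. -/
def IsFIP : Prop := Finite (Subalgebra R S)

/-- `R ⊂ S` is a minimal extension: `R ≠ S` and `[R, S] = {R, S}`. -/
def IsMinimal : Prop :=
  (⊥ : Subalgebra R S) ≠ ⊤ ∧ ∀ T : Subalgebra R S, T = ⊥ ∨ T = ⊤

/-- `R ⊆ S` is chained: any two elements of `[R, S]` are comparable. -/
def IsChained : Prop := ∀ T U : Subalgebra R S, T ≤ U ∨ U ≤ T

/-- `R ⊆ S` is Boolean: `[R, S]`, with meet `T ∩ U` and join the product `T U` (the subalgebra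
generated by `T` and `U`), is distributive and each of its elements has a complement. -/
def IsBoolean : Prop :=
  (∀ T U V : Subalgebra R S, T ⊓ (U ⊔ V) = (T ⊓ U) ⊔ (T ⊓ V)) ∧
  (∀ T U V : Subalgebra R S, T ⊔ (U ⊓ V) = (T ⊔ U) ⊓ (T ⊔ V)) ∧
  (∀ T : Subalgebra R S, ∃ T' : Subalgebra R S, T ⊓ T' = ⊥ ∧ T ⊔ T' = ⊤)

end Lattice

section Support

variable {R : Type u} {S : Type v} [CommRing R] [CommRing S] [Algebra R S]

/-- `MSupp R (U / T)`: the maximal ideals of `R` in the support of the `R`-module `U / T`, for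
`R`-subalgebras `T ≤ U` of `S`. -/
def MSupp (T U : Subalgebra R S) : Set (MaximalSpectrum R) :=
  {M | M.toPrimeSpectrum ∈ Module.support R
    (Subalgebra.toSubmodule U ⧸
      (Subalgebra.toSubmodule T).submoduleOf (Subalgebra.toSubmodule U))}

/-- `T` is a splitter of `R ⊆ S` at `X ⊆ MSupp (S / R)`: `MSupp (T / R) = X` and `MSupp (S / T)`
is the complement of `X` in `MSupp (S / R)`. -/
def IsSplitterAt (X : Set (MaximalSpectrum R)) (T : Subalgebra R S) : Prop :=
  X ⊆ MSupp (⊥ : Subalgebra R S) ⊤ ∧ X = MSupp ⊥ T ∧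
    MSupp (⊥ : Subalgebra R S) ⊤ \ X = MSupp T ⊤

/-- `T` is a splitter of `R ⊆ S`. -/
def IsSplitter (T : Subalgebra R S) : Prop :=
  ∃ X : Set (MaximalSpectrum R), IsSplitterAt X T

end Support

section Localization

variable {R : Type u} (S : Type v) [CommRing R] [CommRing S] [Algebra R S]

/-- `R_M`, for a maximal ideal `M` of `R`. -/
abbrev LocBase (M : MaximalSpectrum R) : Type u :=
  Localization M.asIdeal.primeCompl

/-- `S_M`: the localization of the ring `S` at the image of `R \ M`, an algebra over `R_M`. -/
abbrev LocTop (M : MaximalSpectrum R) : Type v :=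
  Localization (Algebra.algebraMapSubmonoid S M.asIdeal.primeCompl)

variable {S}

/-- `T_M`, as an `R_M`-subalgebra of `S_M`: the elements `t / m` with `t ∈ T` and `m ∈ R \ M`. -/
def locSubalgebra (M : MaximalSpectrum R) (T : Subalgebra R S) :
    Subalgebra (LocBase M) (LocTop S M) where
  carrier := {x | ∃ t ∈ T, ∃ m : M.asIdeal.primeCompl,
    x = IsLocalization.mk' (LocTop S M) t
      ⟨algebraMap R S m, Algebra.mem_algebraMapSubmonoid_of_mem m⟩}
  mul_mem' := by
    rintro _ _ ⟨t, ht, m, rfl⟩ ⟨t', ht', m', rfl⟩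
    refine ⟨t * t', T.mul_mem ht ht', m * m', ?_⟩
    rw [← IsLocalization.mk'_mul]
    congr 1
    ext
    simp
  add_mem' := by
    rintro _ _ ⟨t, ht, m, rfl⟩ ⟨t', ht', m', rfl⟩
    refine ⟨t * algebraMap R S m' + t' * algebraMap R S m,
      T.add_mem (T.mul_mem ht (T.algebraMap_mem _)) (T.mul_mem ht' (T.algebraMap_mem _)),
      m * m', ?_⟩
    rw [← IsLocalization.mk'_add]
    congr 1
    ext
    simp
  algebraMap_mem' := by
    intro r
    obtain ⟨r, m, rfl⟩ := IsLocalization.exists_mk'_eq M.asIdeal.primeCompl r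
    refine ⟨algebraMap R S r, T.algebraMap_mem _, m, ?_⟩
    exact IsLocalization.algebraMap_mk' S (LocBase M) (LocTop S M) r m

variable (R S)

/-- `R ⊆ S` is locally minimal: `R_M ⊂ S_M` is minimal for each `M ∈ MSupp (S / R)`. -/
def IsLocallyMinimal : Prop :=
  ∀ M ∈ MSupp (⊥ : Subalgebra R S) ⊤, IsMinimal (LocBase M) (LocTop S M)

/-- `R ⊆ S` is arithmetic, i.e. locally chained: `R_M ⊆ S_M` is chained for each
`M ∈ MSupp (S / R)`. (If `M` is not in `MSupp (S / R)`, then `R_M = S_M`.) -/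
def IsArithmetic : Prop :=
  ∀ M ∈ MSupp (⊥ : Subalgebra R S) ⊤, IsChained (LocBase M) (LocTop S M)

/-- `R ⊆ S` is a `𝓑`-extension: the map `T ↦ (T_M)` from `[R, S]` to the product of the
`[R_M, S_M]`, over `M ∈ MSupp (S / R)`, is bijective. -/
def IsBExtension : Prop :=
  Function.Bijective
    (fun (T : Subalgebra R S) (M : MSupp (⊥ : Subalgebra R S) ⊤) => locSubalgebra M.1 T)

end Localization

end RingExt

/-! Every `R_M`-subalgebra of `S_M` is some `T_M`, and `T` is determined by its localizations on
`MSupp (S / R)`. Being a splitter means that at each `M` of the support `T_M` is `R_M` or `S_M`, so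
(1) and (2) agree. A complement of `T` localizes to a complement of `T_M`; in a chain only the two
ends have complements, so (4) gives (2).

The substance is the surjectivity of `T ↦ (T_M)` in the locally minimal case.
`exists_pow_smul_mem_bot` says that a minimal extension of a local ring is supported at the closed
point only. Hence the preimage in `S` of `R_M`, `coatomLoc S M`, is `R_M` at `M` and all of `S_N` at
every other `N` of the support (`locSubalgebra_coatomLoc_of_ne`). Intersecting such subalgebras
realizes any choice of `R_M` or `S_M` at finitely many `M`; FCP makes the support finite. Counting
the product, whose factors each have at least two elements, relates (2) and (3), and complements are
chosen factor by factor. -/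

/-! ### Minimal extensions of a local ring -/

open Polynomial in
/-- If `R` is integrally closed in `S` and `p(s) ∈ R`, then the value at `s` of the quotient of
`p - p(0)` by `X` is also in `R`. -/
theorem aeval_divX_mem_bot {R S : Type*} [CommRing R] [CommRing S] [Algebra R S]
    (hint : ∀ x : S, IsIntegral R x → x ∈ (⊥ : Subalgebra R S)) (s : S) (p : R[X])
    (hp : aeval s p ∈ (⊥ : Subalgebra R S)) : aeval s p.divX ∈ (⊥ : Subalgebra R S) := by
  suffices H : ∀ (n : ℕ) (p : R[X]), p.natDegree ≤ n → aeval s p ∈ (⊥ : Subalgebra R S) →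
      aeval s p.divX ∈ (⊥ : Subalgebra R S) from H _ p le_rfl hp
  intro n
  induction n with
  | zero =>
    intro p hn _
    rw [eq_C_of_natDegree_le_zero hn]
    simp
  | succ n ih =>
    intro p hn hp
    rcases hn.lt_or_eq with h | h
    · exact ih p (by omega) hp
    rcases n with _ | n
    · rw [eq_C_of_natDegree_le_zero (p := p.divX)
        (by rw [natDegree_divX_eq_natDegree_tsub_one]; omega), aeval_C]
      exact Subalgebra.algebraMap_mem _ _
    obtain ⟨r, hr⟩ := Algebra.mem_bot.1 hp
    -- `s` is a root of `p - r`, so its multiple by the leading coefficient is integral over `R`.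
    have hb : p.leadingCoeff • s ∈ (⊥ : Subalgebra R S) := by
      have h1 := isIntegral_leadingCoeff_smul (p - C r) s (by simp [hr])
      rw [leadingCoeff, natDegree_sub_C, coeff_sub, coeff_C_of_ne_zero (by omega), sub_zero] at h1
      exact hint _ h1
    obtain ⟨c, hc⟩ := Algebra.mem_bot.1 hb
    rw [Algebra.smul_def] at hc
    have hpe := p.eraseLead_add_C_mul_X_pow
    rw [h] at hpe
    -- With `b` the leading coefficient and `c = b s` in `R`, trading `b X ^ (n + 2)` for `c X ^ (n
    -- + 1)` lowers the degree bound and changes neither the value at `s` nor that of the quotient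
    -- by `X`.
    have h1 := ih (p.eraseLead + C c * X ^ (n + 1))
      (natDegree_add_le_of_degree_le ((eraseLead_natDegree_le p).trans (by omega))
        (natDegree_C_mul_X_pow_le _ _)) (by
          rw [← hpe] at hp
          simp only [map_add, map_mul, aeval_C, map_pow, aeval_X, hc] at hp ⊢
          convert hp using 2
          ring)
    rw [← hpe]
    rw [divX_add, divX_C_mul_X_pow, if_neg (by omega)] at h1 ⊢
    simp only [map_add, map_mul, aeval_C, map_pow, aeval_X, hc,
      Nat.add_sub_cancel] at h1 ⊢
    convert h1 using 2
    ring

/-- The subalgebra `R + aS` of `S`. -/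
def Subalgebra.botAddSMul {R : Type*} (S : Type*) [CommRing R] [CommRing S] [Algebra R S]
    (a : R) : Subalgebra R S where
  carrier := {x | ∃ (r : R) (t : S), x = algebraMap R S r + a • t}
  mul_mem' := by
    rintro _ _ ⟨r, t, rfl⟩ ⟨r', t', rfl⟩
    refine ⟨r * r', r • t' + r' • t + a • (t * t'), ?_⟩
    simp only [Algebra.smul_def, map_mul]
    ring
  add_mem' := by
    rintro _ _ ⟨r, t, rfl⟩ ⟨r', t', rfl⟩
    refine ⟨r + r', t + t', ?_⟩
    simp only [Algebra.smul_def, map_add]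
    ring
  algebraMap_mem' r := ⟨r, 0, by simp⟩

/-- The subalgebra of the `s ∈ S` such that `a ^ n • s ∈ R` for some `n`. -/
def Subalgebra.powSMulMemBot {R : Type*} (S : Type*) [CommRing R] [CommRing S] [Algebra R S]
    (a : R) : Subalgebra R S where
  carrier := {x | ∃ n : ℕ, a ^ n • x ∈ (⊥ : Subalgebra R S)}
  mul_mem' := by
    rintro x y ⟨n, hn⟩ ⟨m, hm⟩
    refine ⟨n + m, ?_⟩
    convert mul_mem hn hm using 1
    simp only [Algebra.smul_def, map_pow]
    ring
  add_mem' := by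
    rintro x y ⟨n, hn⟩ ⟨m, hm⟩
    refine ⟨n + m, ?_⟩
    rw [smul_add]
    refine add_mem ?_ ?_
    · rw [add_comm, pow_add, mul_smul]
      exact Subalgebra.smul_mem _ hn _
    · rw [pow_add, mul_smul]
      exact Subalgebra.smul_mem _ hm _
  algebraMap_mem' r := ⟨0, by simp⟩

open Polynomial in
/-- The crucial ideal of a minimal extension of a local ring `R` is the maximal ideal: the support
of `S / R` is the closed point. -/
theorem RingExt.exists_pow_smul_mem_bot {R S : Type*} [CommRing R] [CommRing S] [Algebra R S]
    [IsLocalRing R] (hinj : Function.Injective (algebraMap R S))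
    (hmin : ∀ T : Subalgebra R S, T = ⊥ ∨ T = ⊤) {a : R}
    (ha : a ∈ IsLocalRing.maximalIdeal R) (s : S) :
    ∃ n : ℕ, a ^ n • s ∈ (⊥ : Subalgebra R S) := by
  by_contra! hs
  -- The elements carried into `R` by a power of `a` form a subalgebra that misses `s`; by
  -- minimality it is `R`.
  have hA : ∀ x : S, a • x ∈ (⊥ : Subalgebra R S) → x ∈ (⊥ : Subalgebra R S) := by
    rcases hmin (Subalgebra.powSMulMemBot S a) with h | h
    · intro x hx
      rw [← h]
      exact ⟨1, by simpa using hx⟩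
    · obtain ⟨n, hn⟩ : s ∈ Subalgebra.powSMulMemBot S a := h ▸ Algebra.mem_top
      exact absurd hn (hs n)
  have hs0 : s ∉ (⊥ : Subalgebra R S) := by simpa using hs 0
  have hadj : ∀ x : S, x ∉ (⊥ : Subalgebra R S) → Algebra.adjoin R {x} = ⊤ := fun x hx =>
    (hmin _).resolve_left fun h => hx (h ▸ Algebra.self_mem_adjoin_singleton R x)
  have hdiv : ∀ x : S, ∃ (r : R) (t : S), x = algebraMap R S r + a • t := by
    rcases hmin (Subalgebra.botAddSMul S a) with h | h
    · exact absurd (hA s (h ▸ ⟨0, s, by simp⟩)) hs0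
    · intro x
      exact (h ▸ Algebra.mem_top : x ∈ Subalgebra.botAddSMul S a)
  -- An integral `x` outside `R` would make `S = R[x]` a finite module, and `S = R + aS` would then
  -- give `S = R` by Nakayama.
  have hint : ∀ x : S, IsIntegral R x → x ∈ (⊥ : Subalgebra R S) := by
    intro x hx
    by_contra hx0
    have hfg := hx.fg_adjoin_singleton
    rw [hadj x hx0] at hfg
    have := Submodule.le_of_le_smul_of_le_jacobson_bot
      (N := Subalgebra.toSubmodule (⊥ : Subalgebra R S)) (I := IsLocalRing.maximalIdeal R) hfg
      (IsLocalRing.maximalIdeal_le_jacobson _) (by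
        intro y _
        obtain ⟨r, t, rfl⟩ := hdiv y
        exact Submodule.add_mem_sup (Subalgebra.algebraMap_mem _ r)
          (Submodule.smul_mem_smul ha trivial))
    exact hx0 (this (x := x) trivial)
  -- Minimality gives `x = f(a x)`, so `x` is a root of `p = f(aX) - X`, whose linear coefficient is
  -- `-1` modulo the maximal ideal. The two successive quotients of `p` by `X` have values `d`, `e`
  -- in `R` at `x`, with `d x + p₀ = 0` and `e x = d - p₁`.
  have hinv : ∀ x : S, x ∉ (⊥ : Subalgebra R S) → ∃ r : R, algebraMap R S r * x = 1 := by
    intro x hx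
    have hax : a • x ∉ (⊥ : Subalgebra R S) := fun h => hx (hA x h)
    have hmem : x ∈ Algebra.adjoin R {a • x} := hadj _ hax ▸ Algebra.mem_top
    rw [Algebra.adjoin_singleton_eq_range_aeval] at hmem
    obtain ⟨f, hf⟩ := hmem
    have hf : aeval (a • x) f = x := hf
    set p : R[X] := f.comp (C a * X) - X with hp
    have hp0 : aeval x p = 0 := by
      simp [hp, aeval_comp, ← Algebra.smul_def, hf]
    have h1 := aeval_divX_mem_bot hint x p (hp0 ▸ zero_mem _)
    have h2 := aeval_divX_mem_bot hint x _ h1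
    obtain ⟨d, hd⟩ := Algebra.mem_bot.1 h1
    obtain ⟨e, he⟩ := Algebra.mem_bot.1 h2
    have h3 := congrArg (aeval x) p.divX_mul_X_add
    have h4 := congrArg (aeval x) p.divX.divX_mul_X_add
    simp only [map_add, map_mul, aeval_C, aeval_X, hp0, ← hd, ← he, coeff_divX] at h3 h4
    have hc : p.coeff (0 + 1) = f.coeff 1 * a - 1 := by
      simp [hp, comp_C_mul_X_coeff]
    -- A unit `d` would put `x = -p₀ / d` in `R`; so `d` is in the maximal ideal, and `d - p₁` is
    -- congruent to `1`.
    have hu : IsUnit (d - p.coeff (0 + 1)) := by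
      by_cases hdu : IsUnit d
      · refine absurd ?_ hx
        obtain ⟨v, hv⟩ := hdu.exists_left_inv
        have : x = algebraMap R S (-(v * p.coeff 0)) := by
          have hv' := congrArg (algebraMap R S) hv
          rw [map_mul, map_one] at hv'
          rw [map_neg, map_mul]
          linear_combination (algebraMap R S v) * h3 - x * hv'
        rw [this]
        exact Subalgebra.algebraMap_mem _ _
      · rw [hc]
        have : d - f.coeff 1 * a ∈ IsLocalRing.maximalIdeal R :=
          sub_mem hdu (Ideal.mul_mem_left _ _ ha)
        have h5 := IsLocalRing.isUnit_or_isUnit_one_sub_self (-(d - f.coeff 1 * a))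
        rcases h5 with h5 | h5
        · exact absurd (by simpa using h5.neg) this
        · convert h5 using 1
          ring
    obtain ⟨v, hv⟩ := hu.exists_left_inv
    refine ⟨v * e, ?_⟩
    have hv' := congrArg (algebraMap R S) hv
    rw [map_mul, map_one, map_sub] at hv'
    rw [map_mul]
    linear_combination hv' + (algebraMap R S v) * h4
  -- From `r a s = 1` it follows that `r s` is in `R`, so it is an inverse of `a` in `R`.
  obtain ⟨r, hr⟩ := hinv (a • s) fun h => hs0 (hA s h)
  have hb : algebraMap R S r * s ∈ (⊥ : Subalgebra R S) := by
    refine hA _ ?_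
    rw [← mul_smul_comm, hr]
    exact one_mem _
  obtain ⟨b, hb⟩ := Algebra.mem_bot.1 hb
  refine ha (IsUnit.of_mul_eq_one b (hinj ?_))
  rw [map_mul, hb, map_one, ← hr, Algebra.smul_def]
  ring

namespace RingExt

universe u v

variable {R : Type u} {S : Type v} [CommRing R] [CommRing S] [Algebra R S]

/-! ### Localization of subalgebras -/

/-- The preimage in `S` of an `R_M`-subalgebra of `S_M`. -/
def comapLoc (M : MaximalSpectrum R) (W : Subalgebra (LocBase M) (LocTop S M)) :
    Subalgebra R S where
  carrier := {s | algebraMap S (LocTop S M) s ∈ W}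
  mul_mem' hx hy := by simpa using mul_mem hx hy
  add_mem' hx hy := by simpa using add_mem hx hy
  algebraMap_mem' r := by
    rw [Set.mem_ofPred_eq, ← IsScalarTower.algebraMap_apply R S (LocTop S M),
      IsScalarTower.algebraMap_apply R (LocBase M) (LocTop S M)]
    exact W.algebraMap_mem _

theorem mem_comapLoc {M : MaximalSpectrum R} {W : Subalgebra (LocBase M) (LocTop S M)} {s : S} :
    s ∈ comapLoc M W ↔ algebraMap S (LocTop S M) s ∈ W := Iff.rfl

theorem algebraMap_mul_mk' (M : MaximalSpectrum R) (s : S) (m : M.asIdeal.primeCompl) :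
    algebraMap (LocBase M) (LocTop S M) (algebraMap R (LocBase M) m) *
      IsLocalization.mk' (LocTop S M) s
        (⟨algebraMap R S m, Algebra.mem_algebraMapSubmonoid_of_mem m⟩ :
          Algebra.algebraMapSubmonoid S M.asIdeal.primeCompl) = algebraMap S (LocTop S M) s := by
  rw [← IsScalarTower.algebraMap_apply R (LocBase M) (LocTop S M),
    IsScalarTower.algebraMap_apply R S (LocTop S M)]
  exact IsLocalization.mk'_spec' (LocTop S M) s
    ⟨algebraMap R S m, Algebra.mem_algebraMapSubmonoid_of_mem m⟩

/-- Denominators are units of `R_M`, so they do not affect membership in an `R_M`-subalgebra. -/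
theorem mk'_mem_iff {M : MaximalSpectrum R} {W : Subalgebra (LocBase M) (LocTop S M)} {s : S}
    {m : M.asIdeal.primeCompl} :
    IsLocalization.mk' (LocTop S M) s
      (⟨algebraMap R S m, Algebra.mem_algebraMapSubmonoid_of_mem m⟩ :
        Algebra.algebraMapSubmonoid S M.asIdeal.primeCompl) ∈ W ↔ s ∈ comapLoc M W := by
  rw [mem_comapLoc, ← algebraMap_mul_mk' M s m]
  refine ⟨fun h => W.mul_mem (W.algebraMap_mem _) h, fun h => ?_⟩
  obtain ⟨v, hv⟩ := (IsLocalization.map_units (LocBase M) m).exists_left_inv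
  have := W.mul_mem (W.algebraMap_mem v) h
  rwa [← mul_assoc, ← map_mul, hv, map_one, one_mul] at this

theorem exists_eq_mk' (M : MaximalSpectrum R) (x : LocTop S M) :
    ∃ (s : S) (m : M.asIdeal.primeCompl), x = IsLocalization.mk' (LocTop S M) s
      (⟨algebraMap R S m, Algebra.mem_algebraMapSubmonoid_of_mem m⟩ :
        Algebra.algebraMapSubmonoid S M.asIdeal.primeCompl) := by
  obtain ⟨s, ⟨_, m, hm, rfl⟩, rfl⟩ :=
    IsLocalization.exists_mk'_eq (Algebra.algebraMapSubmonoid S M.asIdeal.primeCompl) x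
  exact ⟨s, ⟨m, hm⟩, rfl⟩

/-- Localization at `M` and preimage form a Galois insertion. -/
noncomputable def locInsertion (M : MaximalSpectrum R) :
    GaloisInsertion (locSubalgebra (S := S) M) (comapLoc M) :=
  GaloisConnection.toGaloisInsertion
    (fun T W => by
      constructor
      · intro h t ht
        refine (mk'_mem_iff (m := 1)).1 (h ⟨t, ht, 1, rfl⟩)
      · rintro h _ ⟨t, ht, m, rfl⟩
        exact mk'_mem_iff.2 (h ht))
    (fun W x hx => by
      obtain ⟨s, m, rfl⟩ := exists_eq_mk' M x
      exact ⟨s, mk'_mem_iff.1 hx, m, rfl⟩)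

theorem locSubalgebra_surjective (M : MaximalSpectrum R) :
    Function.Surjective (locSubalgebra (S := S) M) := (locInsertion M).l_surjective

theorem locSubalgebra_mono (M : MaximalSpectrum R) : Monotone (locSubalgebra (S := S) M) :=
  (locInsertion M).gc.monotone_l

theorem locSubalgebra_bot (M : MaximalSpectrum R) : locSubalgebra M (⊥ : Subalgebra R S) = ⊥ :=
  (locInsertion M).gc.l_bot

theorem locSubalgebra_top (M : MaximalSpectrum R) : locSubalgebra M (⊤ : Subalgebra R S) = ⊤ :=
  (locInsertion M).l_top

theorem locSubalgebra_sup (M : MaximalSpectrum R) (T U : Subalgebra R S) :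
    locSubalgebra M (T ⊔ U) = locSubalgebra M T ⊔ locSubalgebra M U :=
  (locInsertion M).gc.l_sup

theorem algebraMap_mem_locSubalgebra {M : MaximalSpectrum R} {T : Subalgebra R S} {s : S} :
    algebraMap S (LocTop S M) s ∈ locSubalgebra M T ↔ ∃ m ∉ M.asIdeal, m • s ∈ T := by
  constructor
  · rintro ⟨t, ht, m, h⟩
    rw [IsLocalization.eq_mk'_iff_mul_eq, ← map_mul,
      IsLocalization.eq_iff_exists (Algebra.algebraMapSubmonoid S M.asIdeal.primeCompl)] at h
    obtain ⟨⟨_, c, hc, rfl⟩, h⟩ := h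
    refine ⟨c * m, M.asIdeal.primeCompl.mul_mem hc m.2, ?_⟩
    have h2 : (c * (m : R)) • s = c • t := by
      simp only [Algebra.smul_def, map_mul] at h ⊢
      linear_combination h
    rw [h2]
    exact T.smul_mem ht c
  · rintro ⟨m, hm, h⟩
    refine ⟨_, h, ⟨m, hm⟩, ?_⟩
    rw [IsLocalization.eq_mk'_iff_mul_eq, ← map_mul, Algebra.smul_def, mul_comm]

theorem locSubalgebra_le_iff {M : MaximalSpectrum R} {T U : Subalgebra R S} :
    locSubalgebra M U ≤ locSubalgebra M T ↔ ∀ u ∈ U, ∃ m ∉ M.asIdeal, m • u ∈ T := by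
  rw [(locInsertion M).gc.le_iff_le]
  exact forall₂_congr fun u _ => algebraMap_mem_locSubalgebra

/-- Not formal, as localization is the left adjoint: the product of two denominators serves both
subalgebras. This limits the statement to finite meets. -/
theorem locSubalgebra_inf (M : MaximalSpectrum R) (T U : Subalgebra R S) :
    locSubalgebra M (T ⊓ U) = locSubalgebra M T ⊓ locSubalgebra M U := by
  refine le_antisymm (le_inf (locSubalgebra_mono M inf_le_left)
    (locSubalgebra_mono M inf_le_right)) ?_
  intro x hx
  obtain ⟨s, m, rfl⟩ := exists_eq_mk' M x
  rw [mk'_mem_iff, mem_comapLoc] at hx ⊢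
  obtain ⟨a, ha, has⟩ := algebraMap_mem_locSubalgebra.1 hx.1
  obtain ⟨b, hb, hbs⟩ := algebraMap_mem_locSubalgebra.1 hx.2
  refine algebraMap_mem_locSubalgebra.2 ⟨a * b, M.asIdeal.primeCompl.mul_mem ha hb, ?_, ?_⟩
  · rw [mul_comm, mul_smul]
    exact T.smul_mem has _
  · rw [mul_smul]
    exact U.smul_mem hbs _

theorem locSubalgebra_finset_inf (M : MaximalSpectrum R) {ι : Type*} (s : Finset ι)
    (f : ι → Subalgebra R S) :
    locSubalgebra M (s.inf f) = s.inf fun i => locSubalgebra M (f i) :=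
  Finset.apply_inf_eq_inf_comp _ (locSubalgebra_inf M) (locSubalgebra_top M)

/-! ### Supports, the local-global principle and splitters -/

theorem notMem_MSupp_iff {M : MaximalSpectrum R} {T U : Subalgebra R S} :
    M ∉ MSupp T U ↔ locSubalgebra M U ≤ locSubalgebra M T := by
  rw [locSubalgebra_le_iff, MSupp, Set.mem_ofPred_eq, Module.notMem_support_iff']
  constructor
  · intro h u hu
    obtain ⟨r, hr, h⟩ := h (Submodule.Quotient.mk ⟨u, hu⟩)
    rw [← Submodule.Quotient.mk_smul, Submodule.Quotient.mk_eq_zero] at h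
    exact ⟨r, hr, h⟩
  · intro h x
    obtain ⟨⟨u, hu⟩, rfl⟩ := Submodule.Quotient.mk_surjective _ x
    obtain ⟨r, hr, h⟩ := h u hu
    refine ⟨r, hr, ?_⟩
    rw [← Submodule.Quotient.mk_smul, Submodule.Quotient.mk_eq_zero]
    exact h

theorem mem_MSupp_bot_iff {M : MaximalSpectrum R} {T : Subalgebra R S} :
    M ∈ MSupp ⊥ T ↔ locSubalgebra M T ≠ ⊥ := by
  rw [← not_iff_not, notMem_MSupp_iff, locSubalgebra_bot, le_bot_iff, not_not]

theorem mem_MSupp_top_iff {M : MaximalSpectrum R} {T : Subalgebra R S} :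
    M ∈ MSupp T ⊤ ↔ locSubalgebra M T ≠ ⊤ := by
  rw [← not_iff_not, notMem_MSupp_iff, locSubalgebra_top, top_le_iff, not_not]

theorem mem_MSupp_bot_top_iff {M : MaximalSpectrum R} :
    M ∈ MSupp (⊥ : Subalgebra R S) ⊤ ↔
      (⊥ : Subalgebra (LocBase M) (LocTop S M)) ≠ ⊤ := by
  rw [mem_MSupp_top_iff, locSubalgebra_bot]

theorem le_of_locSubalgebra_le {T U : Subalgebra R S}
    (h : ∀ M ∈ MSupp (⊥ : Subalgebra R S) ⊤, locSubalgebra M T ≤ locSubalgebra M U) :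
    T ≤ U := by
  have h' : ∀ M, locSubalgebra M T ≤ locSubalgebra M U := fun M => by
    by_cases hM : M ∈ MSupp (⊥ : Subalgebra R S) ⊤
    · exact h M hM
    · exact (locSubalgebra_mono M le_top).trans
        ((notMem_MSupp_iff.1 hM).trans (locSubalgebra_mono M bot_le))
  intro t ht
  -- The ideal of the `r` with `r t` in `U`; by hypothesis it lies in no maximal ideal.
  set I : Ideal R := (Subalgebra.toSubmodule U).comap (LinearMap.toSpanSingleton R S t) with hI
  by_contra htU
  have hne : I ≠ ⊤ := fun hI => htU <| by
    have : (1 : R) ∈ I := hI ▸ Submodule.mem_top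
    simpa [I] using this
  obtain ⟨M, hM, hIM⟩ := Ideal.exists_le_maximal I hne
  obtain ⟨m, hm, hmt⟩ := locSubalgebra_le_iff.1 (h' ⟨M, hM⟩) t ht
  exact hm (hIM hmt)

theorem eq_of_locSubalgebra_eq {T U : Subalgebra R S}
    (h : ∀ M ∈ MSupp (⊥ : Subalgebra R S) ⊤, locSubalgebra M T = locSubalgebra M U) :
    T = U :=
  le_antisymm (le_of_locSubalgebra_le fun M hM => (h M hM).le)
    (le_of_locSubalgebra_le fun M hM => (h M hM).ge)

theorem forall_isSplitter_iff :
    (∀ T : Subalgebra R S, IsSplitter T) ↔ IsLocallyMinimal R S := by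
  constructor
  · intro h M hM
    refine ⟨mem_MSupp_bot_top_iff.1 hM, fun W => ?_⟩
    obtain ⟨T, rfl⟩ := locSubalgebra_surjective M W
    obtain ⟨X, -, rfl, hX⟩ := h T
    by_contra! hT
    have hMT := mem_MSupp_top_iff.2 hT.2
    rw [← hX] at hMT
    exact hMT.2 (mem_MSupp_bot_iff.2 hT.1)
  · intro h T
    have hsub : MSupp ⊥ T ⊆ MSupp (⊥ : Subalgebra R S) ⊤ := fun M hM => by
      rw [mem_MSupp_bot_iff] at hM ⊢
      exact fun h0 => hM (le_bot_iff.1 ((locSubalgebra_mono M le_top).trans h0.le))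
    refine ⟨_, hsub, rfl, Set.ext fun M => ?_⟩
    rw [Set.mem_sdiff, mem_MSupp_top_iff (T := T), mem_MSupp_bot_iff (T := T), not_not]
    constructor
    · rintro ⟨hM, h0⟩
      rw [h0]
      exact mem_MSupp_bot_top_iff.1 hM
    · intro hT
      have hM : M ∈ MSupp (⊥ : Subalgebra R S) ⊤ := mem_MSupp_bot_top_iff.2 fun h0 =>
        hT (top_le_iff.1 (h0 ▸ bot_le))
      exact ⟨hM, ((h M hM).2 _).resolve_right hT⟩

/-! ### Subalgebras trivial at one maximal ideal, and the `𝓑` property -/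

/-- The largest subalgebra whose localization at `M` is `R_M`. -/
noncomputable abbrev coatomLoc (S : Type v) [CommRing S] [Algebra R S] (M : MaximalSpectrum R) :
    Subalgebra R S := comapLoc M ⊥

theorem locSubalgebra_coatomLoc_self (M : MaximalSpectrum R) :
    locSubalgebra M (coatomLoc S M) = ⊥ := (locInsertion M).l_u_eq _

theorem mem_coatomLoc {M : MaximalSpectrum R} {s : S} :
    s ∈ coatomLoc S M ↔ ∃ m ∉ M.asIdeal, m • s ∈ (⊥ : Subalgebra R S) := by
  rw [mem_comapLoc, ← locSubalgebra_bot, algebraMap_mem_locSubalgebra]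

theorem locSubalgebra_coatomLoc_of_ne (hinj : Function.Injective (algebraMap R S))
    {M N : MaximalSpectrum R} (hN : IsMinimal (LocBase N) (LocTop S N)) (hMN : M ≠ N) :
    locSubalgebra N (coatomLoc S M) = ⊤ := by
  rw [← top_le_iff, ← locSubalgebra_top, locSubalgebra_le_iff]
  intro s _
  set I : Ideal R :=
    (Subalgebra.toSubmodule (⊥ : Subalgebra R S)).comap (LinearMap.toSpanSingleton R S s)
  have hI : ∀ {r : R}, r ∈ I ↔ r • s ∈ (⊥ : Subalgebra R S) := Iff.rfl
  -- It suffices to find `m ∉ M` and `n ∉ N` with `m n s` in `R`. Otherwise a prime `Q ⊇ I` avoids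
  -- all such products, so `Q ⊆ M ∩ N`.
  suffices H : ¬ Disjoint (I : Set R)
      ((M.asIdeal.primeCompl ⊔ N.asIdeal.primeCompl : Submonoid R) : Set R) by
    obtain ⟨x, hx, hx'⟩ := Set.not_disjoint_iff.1 H
    obtain ⟨m, hm, n, hn, rfl⟩ := Submonoid.mem_sup.1 hx'
    exact ⟨n, hn, mem_coatomLoc.2 ⟨m, hm, by rw [← mul_smul]; exact hx⟩⟩
  intro hd
  obtain ⟨Q, hQ, hIQ, hQd⟩ := Ideal.exists_le_prime_disjoint _ _ hd
  have hQM : Q ≤ M.asIdeal := fun q hq => by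
    by_contra hqM
    exact Set.disjoint_left.1 hQd hq (Submonoid.mem_sup_left (S := M.asIdeal.primeCompl) hqM)
  have hQN : Q ≤ N.asIdeal := fun q hq => by
    by_contra hqN
    exact Set.disjoint_left.1 hQd hq (Submonoid.mem_sup_right (T := N.asIdeal.primeCompl) hqN)
  -- `Q` is strictly below `N`, whereas minimality at `N` puts some `m a ^ n`, with `m ∉ N`, in `I ⊆
  -- Q`.
  obtain ⟨a, haN, haQ⟩ : ∃ a ∈ N.asIdeal, a ∉ Q := by
    by_contra! h
    exact hMN (MaximalSpectrum.ext
      (N.isMaximal.eq_of_le M.isMaximal.ne_top ((show N.asIdeal ≤ Q from h).trans hQM)).symm)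
  obtain ⟨n, hn⟩ := exists_pow_smul_mem_bot
    (localizationAlgebra_injective (LocBase N) (LocTop S N) hinj) hN.2
    ((IsLocalization.AtPrime.to_map_mem_maximal_iff (LocBase N) N.asIdeal a).2 haN)
    (algebraMap S (LocTop S N) s)
  have hn' : algebraMap S (LocTop S N) (a ^ n • s) ∈
      locSubalgebra N (⊥ : Subalgebra R S) := by
    rw [locSubalgebra_bot]
    convert hn using 1
    rw [Algebra.smul_def, Algebra.smul_def, map_mul, ← map_pow,
      ← IsScalarTower.algebraMap_apply R (LocBase N) (LocTop S N),
      ← IsScalarTower.algebraMap_apply R S (LocTop S N)]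
  obtain ⟨m, hm, hms⟩ := algebraMap_mem_locSubalgebra.1 hn'
  rw [← mul_smul] at hms
  rcases hQ.mem_or_mem (hIQ (hI.2 hms)) with h | h
  · exact hm (hQN h)
  · exact haQ (hQ.mem_of_pow_mem _ h)

theorem finite_MSupp (hinj : Function.Injective (algebraMap R S)) (hFCP : IsFCP R S)
    (hmin : IsLocallyMinimal R S) : (MSupp (⊥ : Subalgebra R S) ⊤).Finite := by
  by_contra hinf
  have hinf : Infinite (MSupp (⊥ : Subalgebra R S) ⊤) := Set.infinite_coe_iff.2 hinf
  set f : ℕ ↪ MSupp (⊥ : Subalgebra R S) ⊤ := Infinite.natEmbedding _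
  -- An infinite support gives a strictly decreasing sequence: at the `i`-th maximal ideal, `U i` is
  -- everything, while `U j` is trivial for `j > i`.
  set U : ℕ → Subalgebra R S := fun k => (Finset.range k).inf fun i => coatomLoc S (f i).1 with hU
  have hanti : Antitone U := fun i j hij => Finset.inf_mono (Finset.range_mono hij)
  have hlt : ∀ i j, i < j → U i ≠ U j := by
    intro i j hij h
    have h1 : locSubalgebra (f i).1 (U i) = ⊤ := by
      rw [hU, locSubalgebra_finset_inf, Finset.inf_eq_top_iff]
      intro k hk
      refine locSubalgebra_coatomLoc_of_ne hinj (hmin _ (f i).2) fun h => ?_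
      have := f.injective (Subtype.ext h)
      exact (Finset.mem_range.1 hk).ne this
    have h2 : locSubalgebra (f i).1 (U j) = ⊥ := by
      rw [hU, locSubalgebra_finset_inf, ← le_bot_iff]
      refine (Finset.inf_le (Finset.mem_range.2 hij)).trans ?_
      rw [locSubalgebra_coatomLoc_self]
    exact mem_MSupp_bot_top_iff.1 (f i).2 (h2.symm.trans ((congrArg _ h.symm).trans h1))
  have hUinj : Function.Injective U := fun i j h => by
    by_contra hij
    rcases lt_or_gt_of_ne hij with hij | hij
    · exact hlt i j hij h
    · exact hlt j i hij h.symm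
  refine Set.infinite_range_of_injective hUinj (hFCP _ ?_)
  rintro _ ⟨i, rfl⟩ _ ⟨j, rfl⟩ -
  exact (le_total i j).symm.imp (fun h => hanti h) fun h => hanti h

theorem IsLocallyMinimal.isBExtension (hinj : Function.Injective (algebraMap R S))
    (hfin : (MSupp (⊥ : Subalgebra R S) ⊤).Finite)
    (hmin : IsLocallyMinimal R S) : IsBExtension R S := by
  classical
  refine ⟨fun T U h => eq_of_locSubalgebra_eq fun M hM => congrFun h ⟨M, hM⟩, fun W => ?_⟩
  have := hfin.fintype
  refine ⟨(Finset.univ.filter fun M => W M = ⊥).inf fun M => coatomLoc S M.1, funext fun N => ?_⟩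
  beta_reduce
  rw [locSubalgebra_finset_inf]
  rcases (hmin N.1 N.2).2 (W N) with h | h
  · rw [h, ← le_bot_iff]
    refine (Finset.inf_le (Finset.mem_filter.2 ⟨Finset.mem_univ N, h⟩)).trans ?_
    rw [locSubalgebra_coatomLoc_self]
  · rw [h, Finset.inf_eq_top_iff]
    intro M hM
    refine locSubalgebra_coatomLoc_of_ne hinj (hmin N.1 N.2) fun h' => ?_
    obtain rfl : M = N := Subtype.ext h'
    exact mem_MSupp_bot_top_iff.1 M.2 ((Finset.mem_filter.1 hM).2.symm.trans h)

/-! ### Counting -/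

theorem IsMinimal.natCard_eq_two {A B : Type*} [CommRing A] [CommRing B] [Algebra A B]
    (h : IsMinimal A B) : Nat.card (Subalgebra A B) = 2 := by
  rw [Nat.card_eq_two_iff]
  exact ⟨⊥, ⊤, h.1, Set.eq_univ_of_forall h.2⟩

theorem isMinimal_of_natCard_eq_two {A B : Type*} [CommRing A] [CommRing B] [Algebra A B]
    (h : Nat.card (Subalgebra A B) = 2) (hne : (⊥ : Subalgebra A B) ≠ ⊤) : IsMinimal A B := by
  refine ⟨hne, fun T => ?_⟩
  obtain ⟨x, y, hxy, hu⟩ := Nat.card_eq_two_iff.1 h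
  have hT : ∀ T : Subalgebra A B, T = x ∨ T = y := fun T => hu.symm.subset (Set.mem_univ T)
  rcases hT T with rfl | rfl <;> rcases hT ⊥ with h1 | h1 <;> rcases hT ⊤ with h2 | h2 <;>
    simp_all

theorem IsLocallyMinimal.natCard (hB : IsBExtension R S)
    (hfin : (MSupp (⊥ : Subalgebra R S) ⊤).Finite) (hmin : IsLocallyMinimal R S) :
    Nat.card (Subalgebra R S) = 2 ^ Set.ncard (MSupp (⊥ : Subalgebra R S) ⊤) := by
  have := hfin.fintype
  rw [Nat.card_congr (Equiv.ofBijective _ hB), Nat.card_pi,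
    Finset.prod_congr rfl fun M _ => (hmin M.1 M.2).natCard_eq_two, Finset.prod_const,
    Finset.card_univ, Set.ncard_eq_toFinset_card', Set.toFinset_card]

theorem isLocallyMinimal_of_natCard (hne : ¬ Function.Surjective (algebraMap R S))
    (hFIP : IsFIP R S) (hB : IsBExtension R S)
    (hcard : Nat.card (Subalgebra R S) = 2 ^ Set.ncard (MSupp (⊥ : Subalgebra R S) ⊤)) :
    IsLocallyMinimal R S := by
  have : Finite (Subalgebra R S) := hFIP
  have hnt : Nontrivial (Subalgebra R S) :=
    ⟨⊥, ⊤, fun h => hne (Algebra.surjective_algebraMap_iff.2 h.symm)⟩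
  have hfin : (MSupp (⊥ : Subalgebra R S) ⊤).Finite := by
    by_contra h
    -- `ncard` of an infinite set is `0`, so the count would be `1`, against `R ≠ S`.
    rw [Set.Infinite.ncard h, pow_zero] at hcard
    exact Finite.one_lt_card.ne' hcard
  have := hfin.fintype
  have hfac : ∀ M : MaximalSpectrum R, Finite (Subalgebra (LocBase M) (LocTop S M)) := fun M =>
    Finite.of_surjective _ (locSubalgebra_surjective M)
  have htwo : ∀ M : MSupp (⊥ : Subalgebra R S) ⊤,
      2 ≤ Nat.card (Subalgebra (LocBase M.1) (LocTop S M.1)) := fun M => by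
    have : Nontrivial (Subalgebra (LocBase M.1) (LocTop S M.1)) :=
      ⟨⊥, ⊤, mem_MSupp_bot_top_iff.1 M.2⟩
    exact Finite.one_lt_card
  rw [Nat.card_congr (Equiv.ofBijective _ hB), Nat.card_pi, Set.ncard_eq_toFinset_card',
    Set.toFinset_card, ← Finset.card_univ, ← Finset.prod_const] at hcard
  intro M hM
  refine isMinimal_of_natCard_eq_two ?_ (mem_MSupp_bot_top_iff.1 hM)
  by_contra h
  -- A single factor above `2` would make the product exceed the power of `2`.
  refine (Finset.prod_lt_prod (fun _ _ => Nat.two_pos) (fun N _ => htwo N)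
    ⟨⟨M, hM⟩, Finset.mem_univ _, ?_⟩).ne' hcard
  exact lt_of_le_of_ne (htwo ⟨M, hM⟩) (Ne.symm h)

/-! ### Boolean and arithmetic extensions -/

theorem IsLocallyMinimal.isArithmetic (hmin : IsLocallyMinimal R S) : IsArithmetic R S := by
  intro M hM T U
  rcases (hmin M hM).2 T with rfl | rfl
  · exact Or.inl bot_le
  · exact Or.inr le_top

theorem IsLocallyMinimal.isBoolean (hB : IsBExtension R S) (hmin : IsLocallyMinimal R S) :
    IsBoolean R S := by
  refine ⟨fun T U V => eq_of_locSubalgebra_eq fun M hM => ?_,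
    fun T U V => eq_of_locSubalgebra_eq fun M hM => ?_, fun T => ?_⟩
  · simp only [locSubalgebra_inf, locSubalgebra_sup]
    rcases (hmin M hM).2 (locSubalgebra M T) with h | h <;> simp [h]
  · simp only [locSubalgebra_inf, locSubalgebra_sup]
    rcases (hmin M hM).2 (locSubalgebra M T) with h | h <;> simp [h]
  · have hc : ∀ M : MSupp (⊥ : Subalgebra R S) ⊤,
        ∃ W, locSubalgebra M.1 T ⊓ W = ⊥ ∧ locSubalgebra M.1 T ⊔ W = ⊤ := fun M => by
      rcases (hmin M.1 M.2).2 (locSubalgebra M.1 T) with h | h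
      · exact ⟨⊤, by simp [h], by simp⟩
      · exact ⟨⊥, by simp, by simp [h]⟩
    choose W hW using hc
    obtain ⟨T', hT'⟩ := hB.2 W
    have hT' : ∀ (M) (hM : M ∈ MSupp (⊥ : Subalgebra R S) ⊤),
        locSubalgebra M T' = W ⟨M, hM⟩ := fun M hM => congrFun hT' ⟨M, hM⟩
    refine ⟨T', eq_of_locSubalgebra_eq fun M hM => ?_, eq_of_locSubalgebra_eq fun M hM => ?_⟩
    · rw [locSubalgebra_inf, locSubalgebra_bot, hT' M hM]
      exact (hW ⟨M, hM⟩).1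
    · rw [locSubalgebra_sup, locSubalgebra_top, hT' M hM]
      exact (hW ⟨M, hM⟩).2

theorem IsBoolean.isLocallyMinimal (hbool : IsBoolean R S) (harith : IsArithmetic R S) :
    IsLocallyMinimal R S := by
  intro M hM
  refine ⟨mem_MSupp_bot_top_iff.1 hM, fun W => ?_⟩
  obtain ⟨T, rfl⟩ := locSubalgebra_surjective M W
  obtain ⟨T', h1, h2⟩ := hbool.2.2 T
  replace h1 := congrArg (locSubalgebra M) h1
  replace h2 := congrArg (locSubalgebra M) h2
  rw [locSubalgebra_inf, locSubalgebra_bot] at h1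
  rw [locSubalgebra_sup, locSubalgebra_top] at h2
  rcases harith M hM (locSubalgebra M T) (locSubalgebra M T') with h | h
  · exact Or.inl (by rwa [inf_eq_left.2 h] at h1)
  · exact Or.inr (by rwa [sup_eq_left.2 h] at h2)

end RingExt

theorem theorem1p161 {R : Type*} {S : Type*} [CommRing R] [CommRing S] [Algebra R S]
    (hinj : Function.Injective (algebraMap R S)) (hne : ¬ Function.Surjective (algebraMap R S))
    (hFCP : RingExt.IsFCP R S) :
    List.TFAE [
      ∀ T : Subalgebra R S, RingExt.IsSplitter T,
      RingExt.IsLocallyMinimal R S,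
      RingExt.IsFIP R S ∧ RingExt.IsBExtension R S ∧
        Nat.card (Subalgebra R S) = 2 ^ Set.ncard (RingExt.MSupp (⊥ : Subalgebra R S) ⊤),
      RingExt.IsBoolean R S ∧ RingExt.IsArithmetic R S ∧ RingExt.IsFIP R S] := by
  have h23 (hmin : RingExt.IsLocallyMinimal R S) :
      RingExt.IsFIP R S ∧ RingExt.IsBExtension R S ∧
        Nat.card (Subalgebra R S) = 2 ^ Set.ncard (RingExt.MSupp (⊥ : Subalgebra R S) ⊤) := by
    have hfin := RingExt.finite_MSupp hinj hFCP hmin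
    have hB := hmin.isBExtension hinj hfin
    have hcard := hmin.natCard hB hfin
    exact ⟨Nat.finite_of_card_ne_zero (by rw [hcard]; positivity), hB, hcard⟩
  tfae_have 1 ↔ 2 := RingExt.forall_isSplitter_iff
  tfae_have 2 → 3 := h23
  tfae_have 3 → 2 := fun h => RingExt.isLocallyMinimal_of_natCard hne h.1 h.2.1 h.2.2
  tfae_have 2 → 4 := fun h => ⟨h.isBoolean (h23 h).2.1, h.isArithmetic, (h23 h).1⟩
  tfae_have 4 → 2 := fun h => h.1.isLocallyMinimal h.2.1
  tfae_finish
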